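/- Let $K$ be a field, let the node set $[n]=\{1,\dots,n\}$ be partitioned into nonempty blocks $B_1,\dots,B_k$, and let $z:[n]\to[k]$ be the block assignment ($u\in B_{z(u)}$). Let $K[x]=K[x_{uv}]$ have one variable $x_{uv}=x_{vu}$ for each edge $\{u,v\}$, $u\ne v$, of the complete graph $K_n$. Let $I\subset K[x]$ be the toric ideal of the $(n,2)$-hypersimplex, i.e. the kernel of the $K$-algebra homomorphism $K[x]\to K[\beta_1,\dots,\beta_n]$, $x_{uv}\mapsto \beta_u\beta_v$, and let $I_{\mathrm{Add}}$ be the toric ideal of the additive stochastic block model, i.e. the kernel of $K[x]\to K[t_1,\dots,t_k]$, $x_{uv}\mapsto t_{z(u)}t_{z(v)}$. Let the sorted basis be $$\mathcal G=\{x_{ab}x_{cd}-x_{ac}x_{bd},\ x_{ad}x_{bc}-x_{ac}x_{bd}\;:\;1\le a<b<c<d\le n\}$$ and let $$\mathcal L=\{x_{uv}-x_{yw}\;:\;u\neq v,\ y\neq w,\ u,y\in B_i,\ v,w\in B_j,\ i,j\in[k]\}.$$ For a monomial order, a Gröbner basis of an ideal is a finite subset whose leading terms generate the initial ideal; it is reduced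 if its elements are monic and no monomial of an element is divisible by the leading monomial of another element. **Theorem.** 1. There is a monomial order for which $\mathcal G$ is the reduced Gröbner basis of $I$. 2. There is a monomial order for which $\mathcal G\cup\mathcal L$ is a Gröbner basis of $I_{\mathrm{Add}}$. If the nodes are labelled so that the blocks are consecutive ($z$ is nondecreasing), then $\mathcal G\cup\mathcal L$ is a Gröbner basis of $I_{\mathrm{Add}}$ for every monomial order for which $\mathcal G$ is the reduced Gröbner basis of $I$. 3. A Markov basis of the additive stochastic block model is given by the exchanges of edges along sorted 4-cycles and the exchanges of an edge for another edge whose endpoints lie in the same respective blocks. Here a sorted 4-cycle is a 4-cycle of $K_n$ on nodes $a<b<c<d$ one of whose two perfect matchings is $\{ac,bd\}$, and the exchange along it replaces one of its perfect matchings by the other. Precisely: for a multigraph $g\in\mathbb N^{\binom n2}$ on $[n]$ without loops, with degrees $\deg_g(v)$, let $T_{\mathrm{Add}}(g)=\bigl(\sum_{v\in B_i}\deg_g(v)\bigr)_{i\in[k]}$. These finitely many moves (integer vectors in $\mathbb Z^{\binom n2}$) preserve $T_{\mathrm{Add}}$, and any two multigraphs $g,h\in\mathbb N^{\binom n2}$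 with $T_{\mathrm{Add}}(g)=T_{\mathrm{Add}}(h)$ are joined by a finite sequence of multigraphs in $\mathbb N^{\binom n2}$ with the same value of $T_{\mathrm{Add}}$, each obtained from the previous one by adding or subtracting one of the moves. -/

import Mathlib

open MvPolynomial

namespace AdditiveSBM

/-! ### Gröbner bases -/

section Groebner

variable {σ K : Type*} [Field K]

/-- A finite set `G` is a Gröbner basis of the ideal `I` with respect to the monomial order `m`:
`G ⊆ I`, and the leading terms of the elements of `G` generate the ideal generated by the leading
terms of all elements of `I`. (The leading term of `0` is `0`, so a zero element is harmless.) -/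
def IsGroebnerBasis (m : MonomialOrder σ) (G : Set (MvPolynomial σ K))
    (I : Ideal (MvPolynomial σ K)) : Prop :=
  G.Finite ∧ (∀ g ∈ G, g ∈ I) ∧
    Ideal.span (m.leadingTerm '' G) = Ideal.span (m.leadingTerm '' (I : Set (MvPolynomial σ K)))

/-- `G` is the reduced Gröbner basis of `I` with respect to `m`: a Gröbner basis whose elements are
monic and in which no monomial of an element is divisible by the leading monomial of a different
element. -/
def IsReducedGroebnerBasis (m : MonomialOrder σ) (G : Set (MvPolynomial σ K))
    (I : Ideal (MvPolynomial σ K)) : Prop :=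
  IsGroebnerBasis m G I ∧ (∀ g ∈ G, m.leadingCoeff g = 1) ∧
    ∀ g ∈ G, ∀ g' ∈ G, g' ≠ g → ∀ c ∈ g.support, ¬ m.degree g' ≤ c

end Groebner

/-! ### Edges of the complete graph and the toric ideals -/

/-- The edges `{u, v}`, `u ≠ v`, of the complete graph on `n` nodes. -/
abbrev Edge (n : ℕ) : Type := {e : Sym2 (Fin n) // ¬ e.IsDiag}

/-- The edge `{u, v}`. -/
def edge {n : ℕ} (u v : Fin n) (h : u ≠ v) : Edge n := ⟨s(u, v), by simpa using h⟩

/-- The homomorphism `ρ` with `x_{uv} ↦ β_u β_v`, the parametrization of the `(n,2)`-hypersimplex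
(of the `β`-model). -/
noncomputable def hypersimplexMap (K : Type*) [Field K] (n : ℕ) :
    MvPolynomial (Edge n) K →ₐ[K] MvPolynomial (Fin n) K :=
  aeval fun e => (e.1.map fun u => (X u : MvPolynomial (Fin n) K)).mul

/-- The toric ideal of the `(n,2)`-hypersimplex. -/
noncomputable def hypersimplexIdeal (K : Type*) [Field K] (n : ℕ) :
    Ideal (MvPolynomial (Edge n) K) :=
  RingHom.ker (hypersimplexMap K n)

/-- The homomorphism `φ` with `x_{uv} ↦ t_{z(u)} t_{z(v)}`, where `z` is the block assignment. -/
noncomputable def addMap (K : Type*) [Field K] {n k : ℕ} (z : Fin n → Fin k) :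
    MvPolynomial (Edge n) K →ₐ[K] MvPolynomial (Fin k) K :=
  aeval fun e => (e.1.map fun u => (X (z u) : MvPolynomial (Fin k) K)).mul

/-- The toric ideal of the additive stochastic block model with block assignment `z`. -/
noncomputable def addIdeal (K : Type*) [Field K] {n k : ℕ} (z : Fin n → Fin k) :
    Ideal (MvPolynomial (Edge n) K) :=
  RingHom.ker (addMap K z)

/-- The variable `x_{uv} = x_{vu}`. -/
noncomputable def x (K : Type*) [Field K] {n : ℕ} (u v : Fin n) (h : u ≠ v) :
    MvPolynomial (Edge n) K :=
  X (edge u v h)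

/-- The sorted basis: for nodes `a < b < c < d`, the pair of edges `{a,c}, {b,d}` is sorted, the
other two pairs `{a,b}, {c,d}` and `{a,d}, {b,c}` are not; each unsorted pair gives the binomial
"unsorted minus sorted". -/
def sortedBasis (K : Type*) [Field K] (n : ℕ) : Set (MvPolynomial (Edge n) K) :=
  {p | ∃ (a b c d : Fin n) (hab : a < b) (hbc : b < c) (hcd : c < d),
    p = x K a b hab.ne * x K c d hcd.ne
        - x K a c (hab.trans hbc).ne * x K b d (hbc.trans hcd).ne ∨
    p = x K a d ((hab.trans hbc).trans hcd).ne * x K b c hbc.ne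
        - x K a c (hab.trans hbc).ne * x K b d (hbc.trans hcd).ne}

/-- The linear binomials `x_{uv} - x_{yw}` with `u, y` in one block and `v, w` in one block. -/
def linearBinomials (K : Type*) [Field K] {n k : ℕ} (z : Fin n → Fin k) :
    Set (MvPolynomial (Edge n) K) :=
  {p | ∃ (u v y w : Fin n) (huv : u ≠ v) (hyw : y ≠ w),
    z u = z y ∧ z v = z w ∧ p = x K u v huv - x K y w hyw}

/-! ### Fibers and Markov bases -/

/-- The degree of the node `v` in the multigraph with edge multiplicities `g`. -/
def deg {n : ℕ} (g : Edge n → ℕ) (v : Fin n) : ℕ :=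
  ∑ e : Edge n with v ∈ e.1, g e

/-- The sufficient statistics of the additive model: the sum of the degrees of the nodes of each
block. -/
def suffStat {n k : ℕ} (z : Fin n → Fin k) (g : Edge n → ℕ) (i : Fin k) : ℕ :=
  ∑ v : Fin n with z v = i, deg g v

/-- One step with a move from `M`: `h = g + m` or `h = g - m` for some `m ∈ M`. -/
def MoveStep {E : Type*} (M : Set (E → ℤ)) (g h : E → ℕ) : Prop :=
  ∃ m ∈ M, (∀ e, (h e : ℤ) = g e + m e) ∨ (∀ e, (h e : ℤ) = g e - m e)

/-- `M` is a Markov basis for the statistic `T` on `E → ℕ`: a finite set of moves that preserve `T`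
such that any two elements of a fiber of `T` are connected by steps with moves from `M`, with only
elements of this fiber (in particular nonnegative ones) along the way. -/
def IsMarkovBasis {E S : Type*} (T : (E → ℕ) → S) (M : Set (E → ℤ)) : Prop :=
  M.Finite ∧
  (∀ m ∈ M, ∀ g h : E → ℕ, (∀ e, (h e : ℤ) = g e + m e) → T h = T g) ∧
  ∀ g h : E → ℕ, T g = T h →
    Relation.ReflTransGen (fun g₁ g₂ => MoveStep M g₁ g₂ ∧ T g₂ = T g₁) g h

/-- The indicator vector of an edge. -/
def ind {n : ℕ} (u v : Fin n) (h : u ≠ v) : Edge n → ℤ := Pi.single (edge u v h) 1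

/-- Exchange of edges along a sorted 4-cycle: a 4-cycle on nodes `a < b < c < d` one of whose two
perfect matchings is the sorted pair `{a,c}, {b,d}`; the move replaces one matching by the other. -/
def sortedCycleMoves (n : ℕ) : Set (Edge n → ℤ) :=
  {m | ∃ (a b c d : Fin n) (hab : a < b) (hbc : b < c) (hcd : c < d),
    m = ind a b hab.ne + ind c d hcd.ne
        - ind a c (hab.trans hbc).ne - ind b d (hbc.trans hcd).ne ∨
    m = ind a d ((hab.trans hbc).trans hcd).ne + ind b c hbc.ne
        - ind a c (hab.trans hbc).ne - ind b d (hbc.trans hcd).ne}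

/-- Exchange of an edge for another edge whose endpoints lie in the same respective blocks. -/
def blockMoves {n k : ℕ} (z : Fin n → Fin k) : Set (Edge n → ℤ) :=
  {m | ∃ (u v y w : Fin n) (huv : u ≠ v) (hyw : y ≠ w),
    z u = z y ∧ z v = z w ∧ m = ind u v huv - ind y w hyw}

end AdditiveSBM

/-!
The theorem comes down to one separation property: if the exponents divisible by no leading
monomial of some binomials are told apart by the statistic that the binomials preserve, then
rewriting with the binomials brings every exponent to the normal form of its fibre. Hence the
binomials are a Gröbner basis of the toric ideal, and their exponent differences a Markov basis.

The separation is Sturmfels' sorting argument. Order the two labels of every edge. If no two edges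
of a multigraph have label pairs that lie side by side or are strictly nested, then the sorted list
of all labels determines the multiset of label pairs: its first half consists of the smaller labels
and its second half of the larger ones. For monotone labels such pairs of edges are unsorted pairs
of nodes, which are excluded as soon as the unsorted monomial leads in every sorted binomial.

A suitable order compares edges by the circular length of their label pair, a shorter edge being a
larger variable: of the three perfect matchings of four points on a circle, the crossing one has
the longest shortest edge. For arbitrary blocks a node is labelled by a representative of its block
and, among edges with equal label pairs, those between representatives are the smallest variables.
Then all edges of a standard monomial with distinct labels join representatives, for which labels
and nodes agree.
-/

namespace AdditiveSBM

open Finsupp (single)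
open scoped MonomialOrder

/-! ### Rewriting with binomials -/

section Rewriting

variable {σ M : Type*} [AddCommMonoid M]

/-- The exponent `c` is standard for the binomials `x^P - x^Q` with `(P, Q) ∈ S`: none of their
leading monomials divides `x^c`. Pairs are not required to list their leading exponent first. -/
def IsStandard (m : MonomialOrder σ) (S : Set ((σ →₀ ℕ) × (σ →₀ ℕ))) (c : σ →₀ ℕ) : Prop :=
  ∀ P Q, (P, Q) ∈ S ∨ (Q, P) ∈ S → P ≤ c → P ≼[m] Q

/-- One rewriting step between exponents, by a binomial of `S` used in either direction. -/
def BinomialStep (S : Set ((σ →₀ ℕ) × (σ →₀ ℕ))) (c c' : σ →₀ ℕ) : Prop :=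
  ∃ P Q d, ((P, Q) ∈ S ∨ (Q, P) ∈ S) ∧ c = d + P ∧ c' = d + Q

variable {m : MonomialOrder σ} {S : Set ((σ →₀ ℕ) × (σ →₀ ℕ))} {T : (σ →₀ ℕ) →+ M}
  {c c' : σ →₀ ℕ}

theorem IsStandard.of_le (hc : IsStandard m S c) (h : c' ≤ c) : IsStandard m S c' :=
  fun P Q hPQ hP => hc P Q hPQ (hP.trans h)

theorem BinomialStep.symm (h : BinomialStep S c c') : BinomialStep S c' c := by
  obtain ⟨P, Q, d, hPQ, hc, hc'⟩ := h
  exact ⟨Q, P, d, hPQ.symm, hc', hc⟩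

theorem BinomialStep.map_eq (hT : ∀ p ∈ S, T p.1 = T p.2) (h : BinomialStep S c c') :
    T c' = T c := by
  obtain ⟨P, Q, d, hPQ | hPQ, rfl, rfl⟩ := h
  · rw [map_add, map_add, hT _ hPQ]
  · rw [map_add, map_add, ← hT _ hPQ]

theorem map_eq_of_reflTransGen_binomialStep (hT : ∀ p ∈ S, T p.1 = T p.2)
    (h : Relation.ReflTransGen (BinomialStep S) c c') : T c' = T c := by
  induction h with
  | refl => rfl
  | tail _ hstep ih => exact (hstep.map_eq hT).trans ih

theorem exists_binomialStep_lt_of_not_isStandard (hc : ¬ IsStandard m S c) :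
    ∃ c', BinomialStep S c c' ∧ c' ≺[m] c := by
  simp only [IsStandard, not_forall, not_le] at hc
  obtain ⟨P, Q, hPQ, hP, hlt⟩ := hc
  obtain ⟨d, rfl⟩ := exists_add_of_le hP
  refine ⟨d + Q, ⟨P, Q, d, hPQ, add_comm P d, rfl⟩, ?_⟩
  rw [add_comm P d, map_add, map_add]
  exact add_lt_add_right hlt _

variable (m S) in
theorem exists_isStandard_reflTransGen (c : σ →₀ ℕ) :
    ∃ c', IsStandard m S c' ∧ c' ≼[m] c ∧ Relation.ReflTransGen (BinomialStep S) c c' := by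
  induction h : m.toSyn c using WellFoundedLT.induction generalizing c with
  | ind s ih =>
    subst h
    by_cases hc : IsStandard m S c
    · exact ⟨c, hc, le_rfl, .refl⟩
    · obtain ⟨d, hstep, hlt⟩ := exists_binomialStep_lt_of_not_isStandard hc
      obtain ⟨c', hc', hle, hpath⟩ := ih _ hlt d rfl
      exact ⟨c', hc', hle.trans hlt.le, .head hstep hpath⟩

theorem reflTransGen_binomialStep_of_injOn (hinj : Set.InjOn T {c | IsStandard m S c})
    (hT : ∀ p ∈ S, T p.1 = T p.2) (h : T c = T c') :
    Relation.ReflTransGen (BinomialStep S) c c' := by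
  obtain ⟨d, hd, -, hcd⟩ := exists_isStandard_reflTransGen m S c
  obtain ⟨d', hd', -, hcd'⟩ := exists_isStandard_reflTransGen m S c'
  obtain rfl : d = d' := hinj hd hd' <| by
    rw [map_eq_of_reflTransGen_binomialStep hT hcd, h,
      map_eq_of_reflTransGen_binomialStep hT hcd']
  have : Std.Symm (BinomialStep S) := ⟨fun _ _ => BinomialStep.symm⟩
  exact hcd.trans (symm hcd')

theorem not_isStandard_of_map_eq_of_lt (hinj : Set.InjOn T {c | IsStandard m S c})
    (hT : ∀ p ∈ S, T p.1 = T p.2) (h : T c = T c') (hlt : c ≺[m] c') : ¬ IsStandard m S c' := by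
  intro hc'
  obtain ⟨d, hd, hle, hcd⟩ := exists_isStandard_reflTransGen m S c
  obtain rfl : d = c' := hinj hd hc' ((map_eq_of_reflTransGen_binomialStep hT hcd).trans h)
  exact hle.not_gt hlt

end Rewriting

/-! ### Binomials and Gröbner bases -/

theorem exists_ne_map_eq_of_map_eq_zero {σ τ R : Type*} [CommSemiring R]
    {T : (σ →₀ ℕ) → (τ →₀ ℕ)} {φ : MvPolynomial σ R →ₗ[R] MvPolynomial τ R}
    (hφ : ∀ c a, φ (monomial c a) = monomial (T c) a) {f : MvPolynomial σ R} (hf : φ f = 0)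
    {c : σ →₀ ℕ} (hc : c ∈ f.support) : ∃ d ∈ f.support, d ≠ c ∧ T d = T c := by
  classical
  by_contra! hne
  refine mem_support_iff.1 hc ?_
  have hsum : φ f = ∑ d ∈ f.support, monomial (T d) (coeff d f) := by
    conv_lhs => rw [f.as_sum, map_sum, Finset.sum_congr rfl fun d _ => hφ d _]
  have hcoeff := congrArg (coeff (T c)) (hsum.symm.trans hf)
  rwa [coeff_sum, Finset.sum_eq_single_of_mem c hc fun d hd hdc => by
    rw [coeff_monomial, if_neg (hne d hd hdc)], coeff_monomial, if_pos rfl, coeff_zero] at hcoeff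

section Binomial

variable {σ R : Type*} [CommRing R] {m : MonomialOrder σ} {S : Set ((σ →₀ ℕ) × (σ →₀ ℕ))}

/-- The binomial `x^P - x^Q` of a pair of exponents `(P, Q)`. -/
noncomputable def binomial (R : Type*) [CommRing R] (p : (σ →₀ ℕ) × (σ →₀ ℕ)) : MvPolynomial σ R :=
  monomial p.1 1 - monomial p.2 1

theorem binomial_swap (p : (σ →₀ ℕ) × (σ →₀ ℕ)) : binomial R p.swap = -binomial R p :=
  (neg_sub _ _).symm

variable [Nontrivial R]

theorem mem_support_binomial {p : (σ →₀ ℕ) × (σ →₀ ℕ)} (hp : p.1 ≠ p.2) {c : σ →₀ ℕ} :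
    c ∈ (binomial R p).support ↔ c = p.1 ∨ c = p.2 := by
  classical
  rw [binomial, mem_support_iff, coeff_sub, coeff_monomial, coeff_monomial]
  split_ifs <;> simp_all [eq_comm]

theorem degree_monomial_lt {P Q : σ →₀ ℕ} (h : Q ≺[m] P) :
    m.degree (monomial Q (1 : R)) ≺[m] m.degree (monomial P (1 : R)) := by
  classical
  simpa [m.degree_monomial] using h

theorem degree_binomial {p : (σ →₀ ℕ) × (σ →₀ ℕ)} (h : p.2 ≺[m] p.1) :
    m.degree (binomial R p) = p.1 := by
  classical
  simp [binomial, m.degree_sub_of_lt (degree_monomial_lt h), m.degree_monomial]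

theorem leadingCoeff_binomial {p : (σ →₀ ℕ) × (σ →₀ ℕ)} (h : p.2 ≺[m] p.1) :
    m.leadingCoeff (binomial R p) = 1 := by
  simp [binomial, m.leadingCoeff_sub_of_lt (degree_monomial_lt h)]

theorem monomial_mem_span_leadingTerm {P Q : σ →₀ ℕ} (hPQ : (P, Q) ∈ S ∨ (Q, P) ∈ S)
    (h : Q ≺[m] P) : monomial P (1 : R) ∈ Ideal.span (m.leadingTerm '' (binomial R '' S)) := by
  have hlead : m.leadingTerm (binomial R (P, Q)) = monomial P 1 := by
    rw [MonomialOrder.leadingTerm, degree_binomial h, leadingCoeff_binomial h]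
  rcases hPQ with hPQ | hQP
  · rw [← hlead]
    exact Ideal.subset_span ⟨_, ⟨_, hPQ, rfl⟩, rfl⟩
  · have hneg : m.leadingTerm (binomial R (Q, P)) = -monomial P 1 := by
      rw [← hlead, ← Prod.swap_prod_mk, binomial_swap]
      simp [MonomialOrder.leadingTerm]
    rw [← neg_mem_iff, ← hneg]
    exact Ideal.subset_span ⟨_, ⟨_, hQP, rfl⟩, rfl⟩

end Binomial

section Groebner

variable {σ τ K : Type*} [Field K] {m : MonomialOrder σ} {S : Set ((σ →₀ ℕ) × (σ →₀ ℕ))}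

theorem isGroebnerBasis_ker_of_injOn {T : (σ →₀ ℕ) →+ (τ →₀ ℕ)}
    (hinj : Set.InjOn T {c | IsStandard m S c}) (hT : ∀ p ∈ S, T p.1 = T p.2) (hfin : S.Finite)
    {φ : MvPolynomial σ K →ₐ[K] MvPolynomial τ K}
    (hφ : ∀ c a, φ (monomial c a) = monomial (T c) a) :
    IsGroebnerBasis m (binomial K '' S) (RingHom.ker φ) := by
  have hker : ∀ g ∈ binomial K '' S, g ∈ RingHom.ker φ := by
    rintro _ ⟨p, hp, rfl⟩
    rw [RingHom.mem_ker, binomial, map_sub, hφ, hφ, hT p hp, sub_self]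
  refine ⟨hfin.image _, hker, (Ideal.span_mono (Set.image_mono hker)).antisymm ?_⟩
  rw [Ideal.span_le]
  rintro _ ⟨f, hf, rfl⟩
  obtain rfl | hf0 := eq_or_ne f 0
  · simp
  obtain ⟨d, hd, hne, hTd⟩ :=
    exists_ne_map_eq_of_map_eq_zero (φ := φ.toLinearMap) hφ hf (m.degree_mem_support hf0)
  have hlt : d ≺[m] m.degree f := (m.le_degree hd).lt_of_ne (m.toSyn.injective.ne hne)
  have hdiv := not_isStandard_of_map_eq_of_lt hinj hT hTd hlt
  simp only [IsStandard, not_forall, not_le] at hdiv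
  obtain ⟨P, Q, hPQ, hP, hQP⟩ := hdiv
  have hfactor : m.leadingTerm f =
      monomial (m.degree f - P) (m.leadingCoeff f) * monomial P 1 := by
    rw [MonomialOrder.leadingTerm, monomial_mul, mul_one, tsub_add_cancel_of_le hP]
  rw [hfactor]
  exact Ideal.mul_mem_left _ _ (monomial_mem_span_leadingTerm hPQ hQP)

theorem IsGroebnerBasis.isReducedGroebnerBasis {I : Ideal (MvPolynomial σ K)}
    (hI : IsGroebnerBasis m (binomial K '' S) I) (hlt : ∀ p ∈ S, p.2 ≺[m] p.1)
    (hdiv : ∀ p ∈ S, ∀ q ∈ S, q ≠ p → ¬ q.1 ≤ p.1 ∧ ¬ q.1 ≤ p.2) :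
    IsReducedGroebnerBasis m (binomial K '' S) I := by
  refine ⟨hI, ?_, ?_⟩
  · rintro _ ⟨p, hp, rfl⟩
    exact leadingCoeff_binomial (hlt p hp)
  · rintro _ ⟨p, hp, rfl⟩ _ ⟨q, hq, rfl⟩ hne c hc
    rw [degree_binomial (hlt q hq)]
    have hp' : p.1 ≠ p.2 := fun h => (hlt p hp).ne (congrArg _ h.symm)
    have hqp := hdiv p hp q hq (ne_of_apply_ne _ hne)
    rcases (mem_support_binomial hp').1 hc with rfl | rfl
    exacts [hqp.1, hqp.2]

/-- If `p` led with the shared exponent `p.2`, it would divide the term `x^{q.2}` of the other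
binomial, which a reduced Gröbner basis forbids. -/
theorem IsReducedGroebnerBasis.snd_lt_fst {G : Set (MvPolynomial σ K)}
    {I : Ideal (MvPolynomial σ K)} (hG : IsReducedGroebnerBasis m G I)
    {p q : (σ →₀ ℕ) × (σ →₀ ℕ)} (hp : binomial K p ∈ G) (hq : binomial K q ∈ G)
    (hp' : p.1 ≠ p.2) (hq' : q.1 ≠ q.2) (hsnd : q.2 = p.2) (hfst : q.1 ≠ p.1) :
    p.2 ≺[m] p.1 := by
  by_contra hlt
  have hlt' : p.swap.2 ≺[m] p.swap.1 := (not_lt.1 hlt).lt_of_ne (m.toSyn.injective.ne hp')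
  have hdeg : m.degree (binomial K p) = p.2 := by
    rw [← p.swap_swap, binomial_swap, m.degree_neg, degree_binomial hlt', p.swap_swap,
      Prod.fst_swap]
  refine hG.2.2 _ hq _ hp (fun h => hfst ?_) p.2 ((mem_support_binomial hq').2 (.inr hsnd.symm))
    hdeg.le
  rw [binomial, binomial, hsnd, sub_left_inj] at h
  exact (monomial_left_injective one_ne_zero h).symm

end Groebner

/-! ### Binomials and Markov bases -/

section Markov

variable {E : Type*} {S : Set ((E →₀ ℕ) × (E →₀ ℕ))}

/-- The integer vector by which the binomial `x^P - x^Q` of a pair `(P, Q)` moves exponents. -/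
def binomialMove (p : (E →₀ ℕ) × (E →₀ ℕ)) (e : E) : ℤ := p.1 e - p.2 e

theorem BinomialStep.moveStep {c c' : E →₀ ℕ} (h : BinomialStep S c c') :
    MoveStep (binomialMove '' S) c c' := by
  obtain ⟨P, Q, d, hPQ | hQP, rfl, rfl⟩ := h
  · refine ⟨_, ⟨_, hPQ, rfl⟩, .inr fun e => ?_⟩
    simp only [Finsupp.coe_add, Pi.add_apply, Nat.cast_add, binomialMove]
    ring
  · refine ⟨_, ⟨_, hQP, rfl⟩, .inl fun e => ?_⟩
    simp only [Finsupp.coe_add, Pi.add_apply, Nat.cast_add, binomialMove]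
    ring

theorem isMarkovBasis_of_injOn {M U : Type*} [Finite E] [AddCommMonoid M] [IsRightCancelAdd M]
    {m : MonomialOrder E} {T : (E →₀ ℕ) →+ M} {t : (E → ℕ) → U}
    (ht : ∀ c d : E →₀ ℕ, t c = t d ↔ T c = T d)
    (hinj : Set.InjOn T {c | IsStandard m S c}) (hT : ∀ p ∈ S, T p.1 = T p.2) (hfin : S.Finite) :
    IsMarkovBasis t (binomialMove '' S) := by
  refine ⟨hfin.image _, ?_, fun g h hgh => ?_⟩
  · rintro _ ⟨p, hp, rfl⟩ g h hgh
    obtain ⟨c, rfl⟩ := Finsupp.equivFunOnFinite.surjective g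
    obtain ⟨d, rfl⟩ := Finsupp.equivFunOnFinite.surjective h
    have hcd : d + p.2 = c + p.1 := by
      ext e
      have := hgh e
      simp only [Finsupp.equivFunOnFinite_apply, binomialMove] at this
      simp only [Finsupp.add_apply]
      omega
    refine (ht d c).2 (add_right_cancel (b := T p.2) ?_)
    rw [← map_add, hcd, map_add, hT p hp]
  · obtain ⟨c, rfl⟩ := Finsupp.equivFunOnFinite.surjective g
    obtain ⟨d, rfl⟩ := Finsupp.equivFunOnFinite.surjective h
    exact (reflTransGen_binomialStep_of_injOn hinj hT ((ht c d).1 hgh)).lift _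
      fun a b hab => ⟨hab.moveStep, (ht b a).2 (hab.map_eq hT)⟩

end Markov

/-! ### Lexicographic orders -/

section Lex

universe u

variable {σ : Type u} {α : Type*} [LinearOrder α] {key : σ → α}

/-- `m` decides by smallest keys, variables with smaller keys being larger: if some variable of
`x^P` has a smaller key than all variables of `x^Q`, then `x^Q` is smaller than `x^P`. -/
def IsLexFor (m : MonomialOrder σ) (key : σ → α) : Prop :=
  ∀ ⦃e P Q⦄, e ∈ P.support → (∀ f ∈ Q.support, key e < key f) → Q ≺[m] P

variable (key) in
theorem exists_isLexFor [Finite σ] : ∃ m : MonomialOrder.{u, u} σ, IsLexFor m key := by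
  let _ : LinearOrder σ := .lift' (fun e => toLex (key e, Finite.equivFin σ e)) fun e f h =>
    (Finite.equivFin σ).injective (Prod.ext_iff.1 (toLex.injective h)).2
  have key_mono {e f : σ} (h : e ≤ f) : key e ≤ key f := Prod.Lex.monotone_fst _ _ h
  refine ⟨MonomialOrder.lex, fun e P Q he hQ => ?_⟩
  set i := P.support.min' ⟨e, he⟩
  have hiP : i ∈ P.support := P.support.min'_mem _
  have hQ_zero (j : σ) (hj : j ≤ i) : Q j = 0 := by
    by_contra hQj
    have hij := hj.trans (P.support.min'_le e he)
    exact (hQ j (Finsupp.mem_support_iff.2 hQj)).not_ge (key_mono hij)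
  have hP_zero (j : σ) (hj : j < i) : P j = 0 := by
    by_contra hPj
    exact hj.not_ge (P.support.min'_le j (Finsupp.mem_support_iff.2 hPj))
  refine MonomialOrder.lex_lt_iff.2 (Finsupp.Lex.lt_iff.2 ⟨i, fun j hj => ?_, ?_⟩)
  · exact (hQ_zero j hj.le).trans (hP_zero j hj).symm
  · exact (hQ_zero i le_rfl).trans_lt (Nat.pos_of_ne_zero (Finsupp.mem_support_iff.1 hiP))

end Lex

/-! ### Sorted multisets of unordered pairs -/

section Sorted

variable {α : Type*} [LinearOrder α] {s t : Multiset (Sym2 α)}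

/-- The pair `p` neither lies strictly to the left of `q` nor strictly encloses `q`. A multiset is
sorted in the sense of Sturmfels if any two members interlace, in either order. -/
def Interlaces (p q : Sym2 α) : Prop :=
  q.inf ≤ p.sup ∧ (p.inf < q.inf → p.sup ≤ q.sup)

theorem Interlaces.refl (p : Sym2 α) : Interlaces p p :=
  ⟨p.inf_le_sup, fun _ => le_rfl⟩

theorem interlaces_mk {a b c d : α} (hab : a ≤ b) (hcd : c ≤ d) :
    Interlaces s(a, b) s(c, d) ↔ c ≤ b ∧ (a < c → b ≤ d) := by
  simp [Interlaces, hab, hcd]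

theorem exists_list_pairwise_le_of_interlaces (hs : ∀ p ∈ s, ∀ q ∈ s, Interlaces p q) :
    ∃ l : List (α × α), l = s.map (fun p => (p.inf, p.sup)) ∧
      (l.map Prod.fst ++ l.map Prod.snd).Pairwise (· ≤ ·) := by
  set l := (s.map fun p => toLex (p.inf, p.sup)).sort
  have hsort : l.Pairwise (· ≤ ·) := Multiset.pairwise_sort _ _
  have hmem {a : α ×ₗ α} (ha : a ∈ l) : ∃ p ∈ s, toLex (p.inf, p.sup) = a :=
    Multiset.mem_map.1 ((Multiset.mem_sort _).1 ha)
  refine ⟨l.map ofLex, ?_, ?_⟩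
  · rw [← Multiset.map_coe, Multiset.sort_eq, Multiset.map_map]
    rfl
  rw [List.map_map, List.map_map, List.pairwise_append, List.pairwise_map, List.pairwise_map]
  refine ⟨hsort.imp fun h => Prod.Lex.monotone_fst _ _ h, hsort.imp_of_mem fun ha hb h => ?_, ?_⟩
  · obtain ⟨p, hp, rfl⟩ := hmem ha
    obtain ⟨q, hq, rfl⟩ := hmem hb
    exact (Prod.Lex.le_iff.1 h).elim (hs p hp q hq).2 fun h => h.2
  · simp only [List.mem_map]
    rintro _ ⟨a, ha, rfl⟩ _ ⟨b, hb, rfl⟩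
    obtain ⟨p, hp, rfl⟩ := hmem ha
    obtain ⟨q, hq, rfl⟩ := hmem hb
    exact (hs q hq p hp).1

/-- A sorted multiset is read off from the increasing list of all end points of its members: the
first half consists of the left end points, the second half of the right ones. -/
theorem eq_of_interlaces (hs : ∀ p ∈ s, ∀ q ∈ s, Interlaces p q)
    (ht : ∀ p ∈ t, ∀ q ∈ t, Interlaces p q)
    (h : s.map Sym2.inf + s.map Sym2.sup = t.map Sym2.inf + t.map Sym2.sup) : s = t := by
  obtain ⟨l, hls, hl⟩ := exists_list_pairwise_le_of_interlaces hs
  obtain ⟨r, hrt, hr⟩ := exists_list_pairwise_le_of_interlaces ht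
  have hinj : Function.Injective fun p : Sym2 α => (p.inf, p.sup) := fun p q hpq =>
    Sym2.inf_eq_inf_and_sup_eq_sup.1 (Prod.ext_iff.1 hpq)
  refine Multiset.map_injective hinj ?_
  have hends (u : Multiset (Sym2 α)) (l : List (α × α)) (hl : l = u.map fun p => (p.inf, p.sup)) :
      u.map Sym2.inf + u.map Sym2.sup = ↑(l.map Prod.fst ++ l.map Prod.snd) := by
    rw [← Multiset.coe_add, ← Multiset.map_coe, ← Multiset.map_coe, hl, Multiset.map_map,
      Multiset.map_map]
    rfl
  rw [hends s l hls, hends t r hrt, Multiset.coe_eq_coe] at h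
  have heq := h.eq_of_pairwise (fun _ _ _ _ => le_antisymm) hl hr
  have hlen : l.length = r.length := by
    have := congrArg List.length heq
    simp only [List.length_append, List.length_map] at this
    omega
  obtain ⟨hfst, hsnd⟩ := List.append_inj heq (by simpa only [List.length_map] using hlen)
  rw [← hls, ← hrt, ← List.zip_unzip l, ← List.zip_unzip r, List.unzip_eq_map, List.unzip_eq_map,
    hfst, hsnd]

end Sorted

/-! ### Exponents of degree two -/

section PairExp

variable {σ : Type*} {c : σ →₀ ℕ} {e f e' f' g : σ}

/-- The exponent of the product of the variables `e` and `f`. -/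
noncomputable def pairExp (e f : σ) : σ →₀ ℕ := single e 1 + single f 1

theorem pairExp_comm (e f : σ) : pairExp e f = pairExp f e := add_comm _ _

theorem pairExp_eq_iff : pairExp e f = pairExp e' f' ↔ e = e' ∧ f = f' ∨ e = f' ∧ f = e' := by
  rw [pairExp, pairExp, Finsupp.single_add_single_eq_single_add_single one_ne_zero one_ne_zero]
  simp

theorem mem_support_pairExp : g ∈ (pairExp e f).support ↔ g = e ∨ g = f := by
  classical
  simp [pairExp, Finsupp.single_apply, eq_comm, or_iff_not_imp_left]

theorem single_le_iff_mem_support : single e 1 ≤ c ↔ e ∈ c.support := by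
  rw [Finsupp.single_le_iff, Finsupp.mem_support_iff, Nat.one_le_iff_ne_zero]

theorem pairExp_le (hef : e ≠ f) (he : e ∈ c.support) (hf : f ∈ c.support) :
    pairExp e f ≤ c := by
  classical
  intro g
  rw [Finsupp.mem_support_iff] at he hf
  rw [pairExp, Finsupp.add_apply, Finsupp.single_apply, Finsupp.single_apply]
  split_ifs with hge hgf hgf
  · exact absurd (hge.trans hgf.symm) hef
  · subst hge; omega
  · subst hgf; omega
  · omega

theorem degree_pairExp (e f : σ) : (pairExp e f).degree = 2 := by
  simp [pairExp]

theorem eq_of_le_of_degree_eq {d : σ →₀ ℕ} (hle : c ≤ d) (hdeg : c.degree = d.degree) :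
    c = d := by
  obtain ⟨r, rfl⟩ := exists_add_of_le hle
  rw [map_add, left_eq_add, Finsupp.degree_eq_zero_iff] at hdeg
  rw [hdeg, add_zero]

theorem binomial_pairExp (R : Type*) [CommRing R] (e f e' f' : σ) :
    binomial R (pairExp e f, pairExp e' f') = X e * X f - X e' * X f' := by
  simp only [binomial, pairExp, X, monomial_mul, one_mul]

theorem binomialMove_pairExp [DecidableEq σ] (e f e' f' : σ) :
    binomialMove (pairExp e f, pairExp e' f') =
      Pi.single e 1 + Pi.single f 1 - Pi.single e' 1 - Pi.single f' 1 := by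
  ext g
  simp [binomialMove, pairExp, Finsupp.single_apply, Pi.single_apply, eq_comm, sub_sub]

theorem binomialMove_single [DecidableEq σ] (e f : σ) :
    binomialMove (single e 1, single f 1) = Pi.single e 1 - Pi.single f 1 := by
  ext g
  simp [binomialMove, Finsupp.single_apply, Pi.single_apply, eq_comm]

end PairExp

/-! ### Edges and pairs of edges -/

section Edges

variable {n : ℕ} {τ : Type*}

theorem edge_comm {u v : Fin n} (h : u ≠ v) : edge u v h = edge v u h.symm :=
  Subtype.ext Sym2.eq_swap

theorem edge_eq_iff {u v y w : Fin n} (h : u ≠ v) (h' : y ≠ w) :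
    edge u v h = edge y w h' ↔ u = y ∧ v = w ∨ u = w ∧ v = y := by
  rw [edge, edge, Subtype.mk.injEq, Sym2.eq_iff]

theorem exists_edge_le [LinearOrder τ] (z : Fin n → τ) (e : Edge n) :
    ∃ u v, ∃ h : u ≠ v, z u ≤ z v ∧ e = edge u v h := by
  obtain ⟨⟨u, v⟩, he⟩ := e
  have huv : u ≠ v := by simpa using he
  obtain h | h := le_total (z u) (z v)
  · exact ⟨u, v, huv, h, rfl⟩
  · exact ⟨v, u, huv.symm, h, edge_comm huv⟩

/-- The pairs of exponents (unsorted, sorted) of the binomials of the sorted basis. -/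
def sortedPairs (n : ℕ) : Set ((Edge n →₀ ℕ) × (Edge n →₀ ℕ)) :=
  {p | ∃ (a b c d : Fin n) (hab : a < b) (hbc : b < c) (hcd : c < d),
    p = (pairExp (edge a b hab.ne) (edge c d hcd.ne),
      pairExp (edge a c (hab.trans hbc).ne) (edge b d (hbc.trans hcd).ne)) ∨
    p = (pairExp (edge a d ((hab.trans hbc).trans hcd).ne) (edge b c hbc.ne),
      pairExp (edge a c (hab.trans hbc).ne) (edge b d (hbc.trans hcd).ne))}

/-- The pairs of exponents of the linear binomials; the labelling `z` of the nodes may take values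
in any type. -/
def blockPairs (z : Fin n → τ) : Set ((Edge n →₀ ℕ) × (Edge n →₀ ℕ)) :=
  {p | ∃ (u v y w : Fin n) (huv : u ≠ v) (hyw : y ≠ w),
    z u = z y ∧ z v = z w ∧ p = (single (edge u v huv) 1, single (edge y w hyw) 1)}

theorem blockPairs_comp {τ' : Type*} {p : τ → τ'} (hp : Function.Injective p) (z : Fin n → τ) :
    blockPairs (p ∘ z) = blockPairs z := by
  simp only [blockPairs, Function.comp_apply, hp.eq_iff]

variable {p q : (Edge n →₀ ℕ) × (Edge n →₀ ℕ)}

theorem degree_of_mem_sortedPairs (hp : p ∈ sortedPairs n) : p.1.degree = 2 ∧ p.2.degree = 2 := by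
  obtain ⟨a, b, c, d, hab, hbc, hcd, rfl | rfl⟩ := hp <;>
    exact ⟨degree_pairExp _ _, degree_pairExp _ _⟩

theorem degree_of_mem_blockPairs {z : Fin n → τ} (hp : p ∈ blockPairs z) :
    p.1.degree = 1 ∧ p.2.degree = 1 := by
  obtain ⟨u, v, y, w, huv, hyw, -, -, rfl⟩ := hp
  exact ⟨Finsupp.degree_single _ _, Finsupp.degree_single _ _⟩

theorem finite_sortedPairs (n : ℕ) : (sortedPairs n).Finite :=
  ((Finsupp.finite_of_degree_eq 2).prod (Finsupp.finite_of_degree_eq 2)).subset fun _ =>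
    degree_of_mem_sortedPairs

theorem finite_blockPairs (z : Fin n → τ) : (blockPairs z).Finite :=
  ((Finsupp.finite_of_degree_eq 1).prod (Finsupp.finite_of_degree_eq 1)).subset fun _ =>
    degree_of_mem_blockPairs

theorem fst_ne_snd_of_mem_sortedPairs (hp : p ∈ sortedPairs n) (hq : q ∈ sortedPairs n) :
    q.1 ≠ p.2 := by
  obtain ⟨a, b, c, d, hab, hbc, hcd, rfl | rfl⟩ := hp <;>
  obtain ⟨a', b', c', d', hab', hbc', hcd', rfl | rfl⟩ := hq <;>
  simp only [ne_eq, pairExp_eq_iff, edge_eq_iff] <;> omega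

theorem injOn_fst_sortedPairs (n : ℕ) : Set.InjOn Prod.fst (sortedPairs n) := by
  intro p hp q hq h
  refine Prod.ext h ?_
  obtain ⟨a, b, c, d, hab, hbc, hcd, rfl | rfl⟩ := hp <;>
  obtain ⟨a', b', c', d', hab', hbc', hcd', rfl | rfl⟩ := hq <;>
  simp only [pairExp_eq_iff, edge_eq_iff] at h ⊢ <;> omega

theorem not_fst_le_of_mem_sortedPairs (hp : p ∈ sortedPairs n) (hq : q ∈ sortedPairs n)
    (hqp : q ≠ p) : ¬ q.1 ≤ p.1 ∧ ¬ q.1 ≤ p.2 := by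
  have hpdeg := degree_of_mem_sortedPairs hp
  have hqdeg := (degree_of_mem_sortedPairs hq).1
  constructor <;> intro hle
  · exact hqp (injOn_fst_sortedPairs n hq hp (eq_of_le_of_degree_eq hle (hqdeg.trans hpdeg.1.symm)))
  · exact fst_ne_snd_of_mem_sortedPairs hp hq
      (eq_of_le_of_degree_eq hle (hqdeg.trans hpdeg.2.symm))

theorem exists_sortedPairs_snd_eq_fst_ne (hp : p ∈ sortedPairs n) :
    ∃ q ∈ sortedPairs n, q.2 = p.2 ∧ q.1 ≠ p.1 := by
  obtain ⟨a, b, c, d, hab, hbc, hcd, rfl | rfl⟩ := hp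
  · refine ⟨_, ⟨a, b, c, d, hab, hbc, hcd, .inr rfl⟩, rfl, ?_⟩
    simp only [ne_eq, pairExp_eq_iff, edge_eq_iff]
    omega
  · refine ⟨_, ⟨a, b, c, d, hab, hbc, hcd, .inl rfl⟩, rfl, ?_⟩
    simp only [ne_eq, pairExp_eq_iff, edge_eq_iff]
    omega

/-- The binomials of the sorted basis link the sorted one of the three perfect matchings of four
nodes to the other two, so a given matching need not be linked to both of the others. -/
theorem exists_sortedPairs_of_disjoint {u v y w : Fin n} (huv : u ≠ v) (hyw : y ≠ w)
    (huy : u ≠ y) (huw : u ≠ w) (hvy : v ≠ y) (hvw : v ≠ w) :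
    ∃ Q, ((pairExp (edge u v huv) (edge y w hyw), Q) ∈ sortedPairs n ∨
        (Q, pairExp (edge u v huv) (edge y w hyw)) ∈ sortedPairs n) ∧
      (Q = pairExp (edge u y huy) (edge v w hvw) ∨
        Q = pairExp (edge u w huw) (edge v y hvy)) := by
  wlog huv_lt : u < v generalizing u v
  · obtain ⟨Q, hQ, h⟩ := this huv.symm hvy hvw huy huw (by omega)
    rw [edge_comm huv.symm] at hQ
    refine ⟨Q, hQ, h.symm.imp ?_ ?_⟩ <;> rintro rfl <;> rw [pairExp_comm]
  wlog hyw_lt : y < w generalizing y w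
  · obtain ⟨Q, hQ, h⟩ := this hyw.symm huw huy hvw hvy (by omega)
    rw [edge_comm hyw.symm] at hQ
    exact ⟨Q, hQ, h.symm⟩
  wlog huy_lt : u < y generalizing u v y w
  · obtain ⟨Q, hQ, h⟩ :=
      this hyw hyw_lt huv huy.symm hvy.symm huw.symm hvw.symm huv_lt (by omega)
    rw [pairExp_comm] at hQ
    refine ⟨Q, hQ, h.imp ?_ ?_⟩
    · rintro rfl
      rw [edge_comm huy, edge_comm hvw]
    · rintro rfl
      rw [edge_comm huw, edge_comm hvy, pairExp_comm]
  rcases lt_or_gt_of_ne hvy with hvy_lt | hyv_lt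
  · exact ⟨_, .inl ⟨u, v, y, w, huv_lt, hvy_lt, hyw_lt, .inl rfl⟩, .inl rfl⟩
  rcases lt_or_gt_of_ne hvw with hvw_lt | hwv_lt
  · exact ⟨_, .inr ⟨u, y, v, w, huy_lt, hyv_lt, hvw_lt, .inl rfl⟩, .inl rfl⟩
  · refine ⟨_, .inl ⟨u, y, w, v, huy_lt, hyw_lt, hwv_lt, .inr rfl⟩, .inr ?_⟩
    rw [edge_comm hvy]

end Edges

/-! ### The statistic of an exponent -/

section Stat

variable {n k : ℕ} {τ : Type*}

/-- The exponent of the image of a monomial under `x_{uv} ↦ t_{z(u)} t_{z(v)}`. -/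
noncomputable def stat (z : Fin n → τ) : (Edge n →₀ ℕ) →+ (τ →₀ ℕ) :=
  Finsupp.weight fun e => (e.1.map fun u => single (z u) 1).add

theorem stat_single_edge (z : Fin n → τ) {u v : Fin n} (h : u ≠ v) :
    stat z (single (edge u v h) 1) = single (z u) 1 + single (z v) 1 := by
  rw [stat, Finsupp.weight_single, one_smul]
  rfl

theorem stat_comp {τ' : Type*} (p : τ → τ') (z : Fin n → τ) (c : Edge n →₀ ℕ) :
    stat (p ∘ z) c = (stat z c).mapDomain p := by
  refine DFunLike.congr_fun (f := stat (p ∘ z))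
    (g := (Finsupp.mapDomain.addMonoidHom p).comp (stat z)) ?_ c
  ext1 e
  obtain ⟨u, v, h, -, rfl⟩ := exists_edge_le id e
  ext1
  simp [stat_single_edge, Finsupp.mapDomain_add, Finsupp.mapDomain_single]

theorem stat_eq_of_mem_sortedPairs (z : Fin n → τ) :
    ∀ p ∈ sortedPairs n, stat z p.1 = stat z p.2 := by
  rintro p ⟨a, b, c, d, hab, hbc, hcd, rfl | rfl⟩ <;>
  · simp only [pairExp, map_add, stat_single_edge]
    abel

theorem stat_eq_of_mem_blockPairs (z : Fin n → τ) :
    ∀ p ∈ blockPairs z, stat z p.1 = stat z p.2 := by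
  rintro p ⟨u, v, y, w, huv, hyw, huy, hvw, rfl⟩
  simp only [stat_single_edge, huy, hvw]

theorem stat_eq_of_mem_union (z : Fin n → τ) :
    ∀ p ∈ sortedPairs n ∪ blockPairs z, stat z p.1 = stat z p.2 :=
  fun p hp => hp.elim (stat_eq_of_mem_sortedPairs z p) (stat_eq_of_mem_blockPairs z p)

theorem aeval_monomial_one_monomial {σ K : Type*} [CommSemiring K] (t : σ → τ →₀ ℕ)
    (c : σ →₀ ℕ) (a : K) :
    aeval (fun i => monomial (t i) (1 : K)) (monomial c a) = monomial (Finsupp.weight t c) a := by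
  rw [aeval_monomial, algebraMap_eq, Finsupp.weight_apply, monomial_finsupp_sum_index]
  simp only [monomial_pow, one_pow]

theorem addMap_monomial {K : Type*} [Field K] (z : Fin n → Fin k) (c : Edge n →₀ ℕ) (a : K) :
    addMap K z (monomial c a) = monomial (stat z c) a := by
  rw [stat, ← aeval_monomial_one_monomial, addMap]
  congr 2
  ext1 e
  obtain ⟨u, v, h, -, rfl⟩ := exists_edge_le id e
  change (X (z u) * X (z v) : MvPolynomial (Fin k) K) = monomial (single (z u) 1 + single (z v) 1) 1
  rw [X, X, monomial_mul, one_mul]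

theorem deg_coe (c : Edge n →₀ ℕ) (v : Fin n) : deg c v = stat id c v := by
  rw [deg, stat, Finsupp.weight_eq_sum, Finsupp.finsetSum_apply, Finset.sum_filter]
  refine Finset.sum_congr rfl fun e _ => ?_
  obtain ⟨u, w, h, -, rfl⟩ := exists_edge_le id e
  have hmem : (if v ∈ (edge u w h).1 then 1 else 0) = single u 1 v + single w 1 v := by
    simp only [edge, Sym2.mem_iff, Finsupp.single_apply]
    grind
  rw [← mul_boole, hmem]
  rfl

theorem suffStat_coe (z : Fin n → Fin k) (c : Edge n →₀ ℕ) : suffStat z c = stat z c := by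
  ext i
  simp only [suffStat, deg_coe]
  rw [← Function.comp_id z, stat_comp, Finsupp.mapDomain, Finsupp.sum_apply,
    Finsupp.sum_fintype _ _ fun _ => by simp]
  simp [Finsupp.single_apply, Finset.sum_filter]

theorem suffStat_eq_iff (z : Fin n → Fin k) (c d : Edge n →₀ ℕ) :
    suffStat z c = suffStat z d ↔ stat z c = stat z d := by
  rw [suffStat_coe, suffStat_coe, DFunLike.coe_fn_eq]

end Stat

/-! ### Separating standard exponents -/

section Separation

variable {n : ℕ} {ι : Type*} {m : MonomialOrder (Edge n)}
  {S : Set ((Edge n →₀ ℕ) × (Edge n →₀ ℕ))}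

/-- The unordered pair of labels of the end nodes of an edge. -/
def labels (z : Fin n → ι) (e : Edge n) : Sym2 ι := e.1.map z

theorem labels_edge (z : Fin n → ι) {u v : Fin n} (h : u ≠ v) :
    labels z (edge u v h) = s(z u, z v) := rfl

theorem injective_labels_id : Function.Injective (labels (id : Fin n → Fin n)) :=
  (Sym2.map.injective Function.injective_id).comp Subtype.val_injective

theorem single_mem_blockPairs {z : Fin n → ι} {e f : Edge n} (h : labels z e = labels z f) :
    (single e 1, single f 1) ∈ blockPairs z := by
  obtain ⟨u, v, huv, -, rfl⟩ := exists_edge_le id e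
  obtain ⟨y, w, hyw, -, rfl⟩ := exists_edge_le id f
  rw [labels_edge, labels_edge, Sym2.eq_iff] at h
  obtain h | h := h
  · exact ⟨u, v, y, w, huv, hyw, h.1, h.2, rfl⟩
  · exact ⟨u, v, w, y, huv, hyw.symm, h.1, h.2, by rw [edge_comm hyw]⟩

theorem injOn_labels_of_isStandard {z : Fin n → ι} (hS : blockPairs z ⊆ S) :
    Set.InjOn (labels z) {e | IsStandard m S (single e 1)} := by
  intro e he f hf h
  refine Finsupp.single_left_injective one_ne_zero (m.toSyn.injective (le_antisymm ?_ ?_))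
  · exact he _ _ (.inl (hS (single_mem_blockPairs h))) le_rfl
  · exact hf _ _ (.inl (hS (single_mem_blockPairs h.symm))) le_rfl

variable [LinearOrder ι]

theorem map_inf_add_map_sup_labels (z : Fin n → ι) (c : Edge n →₀ ℕ) :
    (c.toMultiset.map (labels z)).map Sym2.inf + (c.toMultiset.map (labels z)).map Sym2.sup =
      (stat z c).toMultiset := by
  induction c using Finsupp.induction_linear with
  | zero => simp
  | add c d hc hd =>
    simp only [map_add, Multiset.map_add, ← hc, ← hd]
    abel
  | single e r =>
    obtain ⟨u, v, huv, hle, rfl⟩ := exists_edge_le z e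
    rw [← Finsupp.smul_single_one, map_nsmul, map_nsmul, map_nsmul, stat_single_edge, map_add]
    simp [Multiset.map_nsmul, labels_edge, hle, ← nsmul_add]

theorem injOn_stat_of_interlaces {z : Fin n → ι}
    (hlabels : Set.InjOn (labels z) {e | IsStandard m S (single e 1)})
    (hsort : ∀ e f, IsStandard m S (pairExp e f) → Interlaces (labels z e) (labels z f)) :
    Set.InjOn (stat z) {c | IsStandard m S c} := by
  have hinterlaces {c : Edge n →₀ ℕ} (hc : IsStandard m S c) :
      ∀ p ∈ c.toMultiset.map (labels z), ∀ q ∈ c.toMultiset.map (labels z), Interlaces p q := by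
    simp only [Multiset.mem_map, Finsupp.mem_toMultiset]
    rintro _ ⟨e, he, rfl⟩ _ ⟨f, hf, rfl⟩
    obtain rfl | hef := eq_or_ne e f
    · exact .refl _
    · exact hsort e f (hc.of_le (pairExp_le hef he hf))
  have hsupport {c : Edge n →₀ ℕ} (hc : IsStandard m S c) :
      (c.support : Set (Edge n)) ⊆ {e | IsStandard m S (single e 1)} := fun e he =>
    hc.of_le (single_le_iff_mem_support.2 he)
  intro c hc d hd h
  refine Finsupp.mapDomain_injOn _ hlabels (hsupport hc) (hsupport hd) ?_
  refine Multiset.toFinsupp.symm.injective ?_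
  simp only [Multiset.toFinsupp_symm_apply]
  rw [← Finsupp.toMultiset_map, ← Finsupp.toMultiset_map]
  refine eq_of_interlaces (hinterlaces hc) (hinterlaces hd) ?_
  rw [map_inf_add_map_sup_labels, map_inf_add_map_sup_labels, h]

/-! ### Monotone labels -/

theorem interlaces_labels_of_monotone (hS : sortedPairs n ⊆ S)
    (hlt : ∀ p ∈ sortedPairs n, p.2 ≺[m] p.1) {z : Fin n → ι} (hz : Monotone z) {e f : Edge n}
    (h : IsStandard m S (pairExp e f)) : Interlaces (labels z e) (labels z f) := by
  obtain ⟨u, v, huv, huv_le, rfl⟩ := exists_edge_le id e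
  obtain ⟨y, w, hyw, hyw_le, rfl⟩ := exists_edge_le id f
  have huv_lt : u < v := huv_le.lt_of_ne huv
  have hyw_lt : y < w := hyw_le.lt_of_ne hyw
  have hnot (Q : Edge n →₀ ℕ) (hQ : (pairExp (edge u v huv) (edge y w hyw), Q) ∈ sortedPairs n) :
      False :=
    (h _ Q (.inl (hS hQ)) le_rfl).not_gt (hlt _ hQ)
  rw [labels_edge, labels_edge, interlaces_mk (hz huv_lt.le) (hz hyw_lt.le)]
  refine ⟨not_lt.1 fun hvy => ?_, fun huy => not_lt.1 fun hwv => ?_⟩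
  · exact hnot _ ⟨u, v, y, w, huv_lt, hz.reflect_lt hvy, hyw_lt, .inl rfl⟩
  · exact hnot _ ⟨u, y, w, v, hz.reflect_lt huy, hyw_lt, hz.reflect_lt hwv, .inr rfl⟩

theorem injOn_stat_of_monotone (hlt : ∀ p ∈ sortedPairs n, p.2 ≺[m] p.1) {z : Fin n → ι}
    (hz : Monotone z) : Set.InjOn (stat z) {c | IsStandard m (sortedPairs n ∪ blockPairs z) c} :=
  injOn_stat_of_interlaces (injOn_labels_of_isStandard Set.subset_union_right) fun _ _ =>
    interlaces_labels_of_monotone Set.subset_union_left hlt hz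

theorem injOn_stat_id (hlt : ∀ p ∈ sortedPairs n, p.2 ≺[m] p.1) :
    Set.InjOn (stat id) {c | IsStandard m (sortedPairs n) c} :=
  injOn_stat_of_interlaces injective_labels_id.injOn fun _ _ =>
    interlaces_labels_of_monotone subset_rfl hlt monotone_id

end Separation

/-! ### Arbitrary blocks -/

section LabelOrder

variable {n : ℕ} {l : Fin n → Fin n} {m : MonomialOrder (Edge n)}

/-- The length of the shorter arc between two nodes when `0, …, n - 1` are placed on a circle. -/
def cyclicDist (s : Sym2 (Fin n)) : ℕ :=
  min (s.sup - s.inf : ℕ) (n - (s.sup - s.inf))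

theorem cyclicDist_mk {a b : Fin n} (h : a ≤ b) :
    cyclicDist s(a, b) = min (b - a : ℕ) (n - (b - a)) := by
  simp [cyclicDist, h]

theorem min_cyclicDist_lt_of_disjoint {a b c d : Fin n} (hab : a ≤ b) (hbc : b < c) (hcd : c ≤ d) :
    min (cyclicDist s(a, b)) (cyclicDist s(c, d)) <
      min (cyclicDist s(a, c)) (cyclicDist s(b, d)) := by
  rw [cyclicDist_mk hab, cyclicDist_mk hcd, cyclicDist_mk (hab.trans hbc.le),
    cyclicDist_mk (hbc.le.trans hcd)]
  omega

theorem min_cyclicDist_lt_of_nested {a b c d : Fin n} (hab : a < b) (hbc : b ≤ c) (hcd : c < d) :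
    min (cyclicDist s(a, d)) (cyclicDist s(b, c)) <
      min (cyclicDist s(a, c)) (cyclicDist s(b, d)) := by
  rw [cyclicDist_mk (hab.le.trans (hbc.trans hcd.le)), cyclicDist_mk hbc,
    cyclicDist_mk (hab.le.trans hbc), cyclicDist_mk (hbc.trans hcd.le)]
  omega

/-- The key of an edge: first the cyclic distance of its labels, then whether both of its end nodes
are their own labels. As `False < True`, edges between such nodes give the smallest variables among
those with the same labels. -/
def labelKey (l : Fin n → Fin n) (e : Edge n) : ℕ ×ₗ Prop :=
  toLex (cyclicDist (labels l e), ∀ u ∈ e.1, l u = u)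

theorem pairExp_lt_of_cyclicDist_lt (hm : IsLexFor m (labelKey l)) {e f e' f' : Edge n}
    (h : min (cyclicDist (labels l e)) (cyclicDist (labels l f)) <
      min (cyclicDist (labels l e')) (cyclicDist (labels l f'))) :
    pairExp e' f' ≺[m] pairExp e f := by
  wlog hle : cyclicDist (labels l e) ≤ cyclicDist (labels l f) generalizing e f
  · rw [pairExp_comm e f]
    exact this (by rwa [min_comm]) (le_of_not_ge hle)
  rw [min_eq_left hle, lt_min_iff] at h
  refine hm (mem_support_pairExp.2 (.inl rfl)) fun g hg => Prod.Lex.toLex_lt_toLex.2 (.inl ?_)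
  obtain rfl | rfl := mem_support_pairExp.1 hg
  exacts [h.1, h.2]

theorem snd_lt_fst_of_isLexFor_labelKey_id (hm : IsLexFor m (labelKey (id : Fin n → Fin n))) :
    ∀ p ∈ sortedPairs n, p.2 ≺[m] p.1 := by
  rintro p ⟨a, b, c, d, hab, hbc, hcd, rfl | rfl⟩
  · exact pairExp_lt_of_cyclicDist_lt hm (min_cyclicDist_lt_of_disjoint hab.le hbc hcd.le)
  · exact pairExp_lt_of_cyclicDist_lt hm (min_cyclicDist_lt_of_nested hab hbc.le hcd)

theorem label_eq_self_of_isStandard (hl : ∀ u, l (l u) = l u) (hm : IsLexFor m (labelKey l))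
    {u v : Fin n} {huv : u ≠ v} (hne : l u ≠ l v)
    (h : IsStandard m (sortedPairs n ∪ blockPairs l) (single (edge u v huv) 1)) :
    l u = u ∧ l v = v := by
  have hlabels : labels l (edge u v huv) = labels l (edge (l u) (l v) hne) := by
    simp only [labels_edge, hl]
  by_contra hnot
  refine (h _ _ (.inl (.inr (single_mem_blockPairs hlabels))) le_rfl).not_gt ?_
  refine hm (e := edge u v huv) (by simp) fun f hf => ?_
  obtain rfl : f = edge (l u) (l v) hne := by simpa using Finsupp.support_single_subset hf
  refine Prod.Lex.toLex_lt_toLex.2 (.inr ⟨congrArg cyclicDist hlabels, ?_⟩)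
  simpa [edge, lt_iff_le_not_ge, hl] using hnot

theorem not_isStandard_of_mem_sortedPairs (hm : IsLexFor m (labelKey l)) {e f e' f' : Edge n}
    (hmem : (pairExp e f, pairExp e' f') ∈ sortedPairs n ∨
      (pairExp e' f', pairExp e f) ∈ sortedPairs n)
    (h : min (cyclicDist (labels l e)) (cyclicDist (labels l f)) <
      min (cyclicDist (labels l e')) (cyclicDist (labels l f'))) :
    ¬ IsStandard m (sortedPairs n ∪ blockPairs l) (pairExp e f) := fun hstd =>
  (hstd _ _ (hmem.imp .inl .inl) le_rfl).not_gt (pairExp_lt_of_cyclicDist_lt hm h)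

theorem not_isStandard_of_forall_matching (hm : IsLexFor m (labelKey l)) {u v y w : Fin n}
    (huv : u ≠ v) (hyw : y ≠ w) (huy : u ≠ y) (huw : u ≠ w) (hvy : v ≠ y) (hvw : v ≠ w)
    (h₁ : min (cyclicDist s(l u, l v)) (cyclicDist s(l y, l w)) <
      min (cyclicDist s(l u, l y)) (cyclicDist s(l v, l w)))
    (h₂ : min (cyclicDist s(l u, l v)) (cyclicDist s(l y, l w)) <
      min (cyclicDist s(l u, l w)) (cyclicDist s(l v, l y))) :
    ¬ IsStandard m (sortedPairs n ∪ blockPairs l) (pairExp (edge u v huv) (edge y w hyw)) := by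
  obtain ⟨Q, hQ, rfl | rfl⟩ := exists_sortedPairs_of_disjoint huv hyw huy huw hvy hvw
  exacts [not_isStandard_of_mem_sortedPairs hm hQ h₁, not_isStandard_of_mem_sortedPairs hm hQ h₂]

variable {u v y w : Fin n} {huv : u ≠ v} {hyw : y ≠ w}

theorem not_isStandard_of_disjoint (hl : ∀ u, l (l u) = l u) (hm : IsLexFor m (labelKey l))
    (h₁ : l u ≤ l v) (h₂ : l v < l y) (h₃ : l y ≤ l w) :
    ¬ IsStandard m (sortedPairs n ∪ blockPairs l) (pairExp (edge u v huv) (edge y w hyw)) := by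
  have hdist := min_cyclicDist_lt_of_disjoint h₁ h₂ h₃
  by_cases heq : l u = l v ∨ l y = l w
  · have hne {a b : Fin n} (h : l a < l b) : a ≠ b := ne_of_apply_ne l h.ne
    -- A repeated label gives the other two matchings the same labels: either may be the partner.
    refine not_isStandard_of_forall_matching hm huv hyw (hne (h₁.trans_lt h₂))
      (hne (h₁.trans_lt (h₂.trans_le h₃))) (hne h₂) (hne (h₂.trans_le h₃)) hdist ?_
    obtain heq | heq := heq
    · rw [heq] at hdist ⊢
      rwa [min_comm (cyclicDist s(l v, l w))]
    · rw [heq] at hdist ⊢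
      exact hdist
  · intro hstd
    obtain ⟨huv_ne, hyw_ne⟩ := not_or.1 heq
    obtain ⟨hu, hv⟩ := label_eq_self_of_isStandard hl hm huv_ne (hstd.of_le le_self_add)
    obtain ⟨hy, hw⟩ := label_eq_self_of_isStandard hl hm hyw_ne (hstd.of_le le_add_self)
    rw [hu, hv] at h₁
    rw [hv, hy] at h₂
    rw [hy, hw] at h₃
    exact not_isStandard_of_mem_sortedPairs hm
      (.inl ⟨u, v, y, w, h₁.lt_of_ne huv, h₂, h₃.lt_of_ne hyw, .inl rfl⟩) hdist hstd

theorem not_isStandard_of_nested (hl : ∀ u, l (l u) = l u) (hm : IsLexFor m (labelKey l))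
    (h₁ : l u < l y) (h₂ : l y ≤ l w) (h₃ : l w < l v) :
    ¬ IsStandard m (sortedPairs n ∪ blockPairs l) (pairExp (edge u v huv) (edge y w hyw)) := by
  have hdist := min_cyclicDist_lt_of_nested h₁ h₂ h₃
  by_cases heq : l y = l w
  · have hne {a b : Fin n} (h : l a < l b) : a ≠ b := ne_of_apply_ne l h.ne
    refine not_isStandard_of_forall_matching hm huv hyw (hne h₁) (hne (h₁.trans_le h₂))
      (hne (h₂.trans_lt h₃)).symm (hne h₃).symm ?_ ?_ <;>
    · rw [heq, Sym2.eq_swap (a := l w) (b := l v)] at hdist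
      rw [heq]
      exact hdist
  · intro hstd
    have huv_ne : l u ≠ l v := (h₁.trans_le (h₂.trans h₃.le)).ne
    obtain ⟨hu, hv⟩ := label_eq_self_of_isStandard hl hm huv_ne (hstd.of_le le_self_add)
    obtain ⟨hy, hw⟩ := label_eq_self_of_isStandard hl hm heq (hstd.of_le le_add_self)
    rw [hu, hy] at h₁
    rw [hy, hw] at h₂
    rw [hw, hv] at h₃
    exact not_isStandard_of_mem_sortedPairs hm
      (.inl ⟨u, y, w, v, h₁, h₂.lt_of_ne hyw, h₃, .inr rfl⟩) hdist hstd

theorem interlaces_labels_of_isStandard (hl : ∀ u, l (l u) = l u) (hm : IsLexFor m (labelKey l))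
    {e f : Edge n} (h : IsStandard m (sortedPairs n ∪ blockPairs l) (pairExp e f)) :
    Interlaces (labels l e) (labels l f) := by
  obtain ⟨u, v, huv, huv_le, rfl⟩ := exists_edge_le l e
  obtain ⟨y, w, hyw, hyw_le, rfl⟩ := exists_edge_le l f
  rw [labels_edge, labels_edge, interlaces_mk huv_le hyw_le]
  exact ⟨not_lt.1 fun hvy => not_isStandard_of_disjoint hl hm huv_le hvy hyw_le h,
    fun huy => not_lt.1 fun hwv => not_isStandard_of_nested hl hm huy hyw_le hwv h⟩

theorem exists_monomialOrder_injOn_stat {τ : Type*} {z : Fin n → τ} (hz : Function.Surjective z) :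
    ∃ m : MonomialOrder.{0, 0} (Edge n),
      Set.InjOn (stat z) {c | IsStandard m (sortedPairs n ∪ blockPairs z) c} := by
  set p := Function.surjInv hz
  have hp : Function.Injective p := Function.injective_surjInv hz
  have hl (u : Fin n) : (p ∘ z) ((p ∘ z) u) = (p ∘ z) u :=
    congrArg p (Function.surjInv_eq hz (z u))
  obtain ⟨m, hm⟩ := exists_isLexFor (labelKey (p ∘ z))
  have hinj : Set.InjOn (stat (p ∘ z)) {c | IsStandard m (sortedPairs n ∪ blockPairs (p ∘ z)) c} :=
    injOn_stat_of_interlaces (injOn_labels_of_isStandard Set.subset_union_right) fun _ _ =>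
      interlaces_labels_of_isStandard hl hm
  rw [blockPairs_comp hp] at hinj
  exact ⟨m, fun c hc d hd h => hinj hc hd (by rw [stat_comp, stat_comp, h])⟩

end LabelOrder

/-! ### The sorted basis and the linear binomials -/

section Bases

variable {n k : ℕ} {K : Type*} [Field K] {m : MonomialOrder (Edge n)}

theorem image_binomial_sortedPairs (K : Type*) [Field K] (n : ℕ) :
    binomial K '' sortedPairs n = sortedBasis K n := by
  ext p
  constructor
  · rintro ⟨_, ⟨a, b, c, d, hab, hbc, hcd, rfl | rfl⟩, rfl⟩
    · exact ⟨a, b, c, d, hab, hbc, hcd, .inl (binomial_pairExp K ..)⟩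
    · exact ⟨a, b, c, d, hab, hbc, hcd, .inr (binomial_pairExp K ..)⟩
  · rintro ⟨a, b, c, d, hab, hbc, hcd, rfl | rfl⟩
    · exact ⟨_, ⟨a, b, c, d, hab, hbc, hcd, .inl rfl⟩, binomial_pairExp K ..⟩
    · exact ⟨_, ⟨a, b, c, d, hab, hbc, hcd, .inr rfl⟩, binomial_pairExp K ..⟩

theorem image_binomial_blockPairs (K : Type*) [Field K] (z : Fin n → Fin k) :
    binomial K '' blockPairs z = linearBinomials K z := by
  ext p
  constructor
  · rintro ⟨_, ⟨u, v, y, w, huv, hyw, huy, hvw, rfl⟩, rfl⟩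
    exact ⟨u, v, y, w, huv, hyw, huy, hvw, rfl⟩
  · rintro ⟨u, v, y, w, huv, hyw, huy, hvw, rfl⟩
    exact ⟨_, ⟨u, v, y, w, huv, hyw, huy, hvw, rfl⟩, rfl⟩

theorem image_binomialMove_sortedPairs (n : ℕ) :
    binomialMove '' sortedPairs n = sortedCycleMoves n := by
  ext q
  constructor
  · rintro ⟨_, ⟨a, b, c, d, hab, hbc, hcd, rfl | rfl⟩, rfl⟩
    · exact ⟨a, b, c, d, hab, hbc, hcd, .inl (binomialMove_pairExp ..)⟩
    · exact ⟨a, b, c, d, hab, hbc, hcd, .inr (binomialMove_pairExp ..)⟩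
  · rintro ⟨a, b, c, d, hab, hbc, hcd, rfl | rfl⟩
    · exact ⟨_, ⟨a, b, c, d, hab, hbc, hcd, .inl rfl⟩, binomialMove_pairExp ..⟩
    · exact ⟨_, ⟨a, b, c, d, hab, hbc, hcd, .inr rfl⟩, binomialMove_pairExp ..⟩

theorem image_binomialMove_blockPairs (z : Fin n → Fin k) :
    binomialMove '' blockPairs z = blockMoves z := by
  ext q
  constructor
  · rintro ⟨_, ⟨u, v, y, w, huv, hyw, huy, hvw, rfl⟩, rfl⟩
    exact ⟨u, v, y, w, huv, hyw, huy, hvw, binomialMove_single ..⟩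
  · rintro ⟨u, v, y, w, huv, hyw, huy, hvw, rfl⟩
    exact ⟨_, ⟨u, v, y, w, huv, hyw, huy, hvw, rfl⟩, binomialMove_single ..⟩

theorem isReducedGroebnerBasis_sortedBasis (hlt : ∀ p ∈ sortedPairs n, p.2 ≺[m] p.1) :
    IsReducedGroebnerBasis m (sortedBasis K n) (hypersimplexIdeal K n) := by
  rw [← image_binomial_sortedPairs]
  have hbasis : IsGroebnerBasis m (binomial K '' sortedPairs n) (hypersimplexIdeal K n) :=
    isGroebnerBasis_ker_of_injOn (injOn_stat_id hlt) (stat_eq_of_mem_sortedPairs id)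
      (finite_sortedPairs n) (addMap_monomial id)
  exact hbasis.isReducedGroebnerBasis hlt fun p hp q hq => not_fst_le_of_mem_sortedPairs hp hq

theorem snd_lt_fst_of_isReducedGroebnerBasis
    (hG : IsReducedGroebnerBasis m (sortedBasis K n) (hypersimplexIdeal K n)) :
    ∀ p ∈ sortedPairs n, p.2 ≺[m] p.1 := by
  intro p hp
  rw [← image_binomial_sortedPairs] at hG
  obtain ⟨q, hq, hsnd, hfst⟩ := exists_sortedPairs_snd_eq_fst_ne hp
  exact hG.snd_lt_fst ⟨p, hp, rfl⟩ ⟨q, hq, rfl⟩ (fst_ne_snd_of_mem_sortedPairs hp hp)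
    (fst_ne_snd_of_mem_sortedPairs hq hq) hsnd hfst

variable {z : Fin n → Fin k}

theorem isGroebnerBasis_addIdeal
    (hinj : Set.InjOn (stat z) {c | IsStandard m (sortedPairs n ∪ blockPairs z) c}) :
    IsGroebnerBasis m (sortedBasis K n ∪ linearBinomials K z) (addIdeal K z) := by
  rw [← image_binomial_sortedPairs, ← image_binomial_blockPairs, ← Set.image_union]
  exact isGroebnerBasis_ker_of_injOn hinj (stat_eq_of_mem_union z)
    ((finite_sortedPairs n).union (finite_blockPairs z)) (addMap_monomial z)

theorem isMarkovBasis_suffStat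
    (hinj : Set.InjOn (stat z) {c | IsStandard m (sortedPairs n ∪ blockPairs z) c}) :
    IsMarkovBasis (suffStat z) (sortedCycleMoves n ∪ blockMoves z) := by
  rw [← image_binomialMove_sortedPairs, ← image_binomialMove_blockPairs, ← Set.image_union]
  exact isMarkovBasis_of_injOn (suffStat_eq_iff z) hinj (stat_eq_of_mem_union z)
    ((finite_sortedPairs n).union (finite_blockPairs z))

end Bases

end AdditiveSBM

theorem mainTheorem4 (K : Type*) [Field K] (n k : ℕ) (z : Fin n → Fin k)
    (hz : Function.Surjective z) :
    (∃ m : MonomialOrder.{0, 0} (AdditiveSBM.Edge n),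
      AdditiveSBM.IsReducedGroebnerBasis m (AdditiveSBM.sortedBasis K n)
        (AdditiveSBM.hypersimplexIdeal K n)) ∧
    (∃ m : MonomialOrder.{0, 0} (AdditiveSBM.Edge n),
      AdditiveSBM.IsGroebnerBasis m
        (AdditiveSBM.sortedBasis K n ∪ AdditiveSBM.linearBinomials K z)
        (AdditiveSBM.addIdeal K z)) ∧
    (Monotone z → ∀ m : MonomialOrder.{0, 0} (AdditiveSBM.Edge n),
      AdditiveSBM.IsReducedGroebnerBasis m (AdditiveSBM.sortedBasis K n)
        (AdditiveSBM.hypersimplexIdeal K n) →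
      AdditiveSBM.IsGroebnerBasis m
        (AdditiveSBM.sortedBasis K n ∪ AdditiveSBM.linearBinomials K z)
        (AdditiveSBM.addIdeal K z)) ∧
    AdditiveSBM.IsMarkovBasis (AdditiveSBM.suffStat z)
      (AdditiveSBM.sortedCycleMoves n ∪ AdditiveSBM.blockMoves z) := by
  obtain ⟨m₀, hm₀⟩ := AdditiveSBM.exists_isLexFor (AdditiveSBM.labelKey (id : Fin n → Fin n))
  obtain ⟨m, hinj⟩ := AdditiveSBM.exists_monomialOrder_injOn_stat hz
  refine ⟨⟨m₀, ?_⟩, ⟨m, AdditiveSBM.isGroebnerBasis_addIdeal hinj⟩, fun hmono m' hG => ?_, ?_⟩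
  · exact AdditiveSBM.isReducedGroebnerBasis_sortedBasis
      (AdditiveSBM.snd_lt_fst_of_isLexFor_labelKey_id hm₀)
  · have hlt := AdditiveSBM.snd_lt_fst_of_isReducedGroebnerBasis hG
    exact AdditiveSBM.isGroebnerBasis_addIdeal (AdditiveSBM.injOn_stat_of_monotone hlt hmono)
  · exact AdditiveSBM.isMarkovBasis_suffStat hinj
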